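/- Let $N\ge 0$, let $\mathcal H=\bigotimes_{k=1}^N\mathbb C^{d_k}$ and $\mathcal H'=\bigotimes_{k=1}^N\mathbb C^{d'_k}$ be $N$-partite systems, and regard $\mathcal H'\otimes\mathcal H$ as an $N$-partite system with local subsystems $\mathbb C^{d'_k}\otimes\mathbb C^{d_k}$. States are unit vectors, and $|\Phi^*\rangle$ denotes the entrywise complex conjugate of $|\Phi\rangle$ in the standard product basis. LOCC protocols consist of finitely many rounds; in each round one party performs a local measurement (finitely many Kraus operators, the local dimension may change) and broadcasts the result, the other parties apply local isometries depending on it, and the continuation may depend on all earlier results; classical results may be forgotten at the end. Definitions. (a) $|\varphi\rangle$ can be locally transformed into $|\psi\rangle$, written $|\varphi\rangle\to|\psi\rangle$, if some LOCC protocol produces $|\psi\rangle$ from $|\varphi\rangle$ with positive probability (the protocol announcing success). (b) Two states of $\mathcal H$ are in the same SLOCC class if each can be locally transformed into the other. A state $|\phi\rangle\in\mathcal H$ is maximally entangled if its SLOCC class is maximal, where a class $\mathcal C$ is maximal if $|\psi\rangle\to|\phi'\rangle$ with $|\psi\rangle\in\mathcal H$ and $|\phi'\rangle\in\mathcal C$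 implies $|\psi\rangle\in\mathcal C$. (c) States $|\chi_1\rangle,\dots,|\chi_D\rangle$ of an $N$-partite system can be unambiguously distinguished with LOCC if there are an LOCC measurement $\{\Pi_i\}_{i=1}^{D+1}$, $\sum_i\Pi_i=I$, and constants $\epsilon_1,\dots,\epsilon_D>0$ with $\langle\chi_j|\Pi_i|\chi_j\rangle=\delta_{ij}\epsilon_i$ for all $i,j\in\{1,\dots,D\}$. (d) A state $|\Phi\rangle\in\mathcal H'$ is universal for local unambiguous discrimination in $\mathcal H$ if for every linearly independent set $\{|\psi_i\rangle\}$ of states of $\mathcal H$ the states $\{|\Phi\rangle\otimes|\psi_i\rangle\}\subset\mathcal H'\otimes\mathcal H$ can be unambiguously distinguished with LOCC. Corollary. A state $|\Phi\rangle\in\mathcal H'$ is universal for local unambiguous discrimination in $\mathcal H$ if and only if for every maximally entangled state $|\phi\rangle\in\mathcal H$, $|\Phi^*\rangle$ can be locally transformed into $|\phi\rangle$. -/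

import Mathlib

open scoped Matrix

noncomputable section

namespace Multipartite

/-- Labels of the standard product basis of `⨂ₖ ℂ^(d k)`. -/
abbrev Idx {N : ℕ} (d : Fin N → ℕ) : Type := ∀ k, Fin (d k)

/-- The `N`-partite Hilbert space `⨂ₖ ℂ^(d k)`: a vector is given by its amplitudes in the
standard product basis, with the Euclidean inner product. -/
abbrev Space {N : ℕ} (d : Fin N → ℕ) : Type := EuclideanSpace ℂ (Idx d)

/-- A pure state is a unit vector. -/
def IsState {N : ℕ} {d : Fin N → ℕ} (φ : Space d) : Prop := ‖φ‖ = 1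

/-- Entrywise complex conjugate in the standard basis. -/
def conjState {N : ℕ} {d : Fin N → ℕ} (φ : Space d) : Space d :=
  WithLp.toLp 2 fun x => star (φ x)

/-- The rank-one operator `|φ⟩⟨φ|`. -/
def ketbra {N : ℕ} {d : Fin N → ℕ} (φ : Space d) : Matrix (Idx d) (Idx d) ℂ :=
  Matrix.vecMulVec φ.ofLp (star φ.ofLp)

/-- The expectation value `⟨φ|E|φ⟩`. -/
def expect {N : ℕ} {d : Fin N → ℕ} (E : Matrix (Idx d) (Idx d) ℂ) (φ : Space d) : ℂ :=
  star φ.ofLp ⬝ᵥ (E *ᵥ φ.ofLp)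

/-- The local dimensions of `H' ⊗ H` viewed as an `N`-partite system whose `k`-th subsystem is
`ℂ^(d' k) ⊗ ℂ^(d k)`. -/
abbrev joint {N : ℕ} (d' d : Fin N → ℕ) : Fin N → ℕ := fun k => d' k * d k

/-- `|Φ⟩ ⊗ |ψ⟩` in `H' ⊗ H`; the basis vector `|a⟩ ⊗ |b⟩` of `ℂ^(d' k) ⊗ ℂ^(d k)` is the basis
vector of `ℂ^(d' k * d k)` with label `finProdFinEquiv (a, b)`. -/
def tensor {N : ℕ} {d' d : Fin N → ℕ} (Φ : Space d') (ψ : Space d) : Space (joint d' d) :=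
  WithLp.toLp 2 fun x =>
    Φ (fun k => (finProdFinEquiv.symm (x k)).1) * ψ (fun k => (finProdFinEquiv.symm (x k)).2)

/-- The product operator `⨂ₖ A k`. -/
def prodOp {N : ℕ} {X Y : Fin N → ℕ} (A : ∀ k, Matrix (Fin (Y k)) (Fin (X k)) ℂ) :
    Matrix (Idx Y) (Idx X) ℂ :=
  Matrix.of fun y x => ∏ k, A k (y k) (x k)

/-- A (finite-round) LOCC protocol on an `N`-partite system with local dimensions `X`, ending
in a system with local dimensions `Z` and announcing a classical outcome in `Ω`.
In each round one party `k` performs a local measurement with Kraus operators `A j k`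
(`j` runs over the results, and the local dimension may change) and broadcasts the result `j`;
each other party `l` then applies a local isometry `A j l`, for instance the identity or the
adjoining of an ancilla; the rest of the protocol depends on `j`. Forgetting results (hence
arbitrary local channels, partial traces and local randomness) is possible because different
branches may end in the same outcome. -/
inductive LOCC {N : ℕ} (Ω : Type) (Z : Fin N → ℕ) : (Fin N → ℕ) → Type
  | halt (ω : Ω) : LOCC Ω Z Z
  | round {X : Fin N → ℕ} (k : Fin N) (m : ℕ) (Y : Fin m → Fin N → ℕ)
      (A : ∀ (j : Fin m) (l : Fin N), Matrix (Fin (Y j l)) (Fin (X l)) ℂ)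
      (measurement : ∑ j, (A j k)ᴴ * A j k = 1)
      (isometry : ∀ j l, l ≠ k → (A j l)ᴴ * A j l = 1)
      (next : ∀ j, LOCC Ω Z (Y j)) : LOCC Ω Z X

/-- The Kraus operators of the branches of a protocol that end in the outcome `ω`. -/
def LOCC.kraus {N : ℕ} {Ω : Type} [DecidableEq Ω] {Z : Fin N → ℕ} (ω : Ω) :
    {X : Fin N → ℕ} → LOCC Ω Z X → List (Matrix (Idx Z) (Idx X) ℂ)
  | _, .halt ω' => if ω' = ω then [1] else []
  | _, .round _ m _ A _ _ next =>
      (List.finRange m).flatMap fun j =>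
        ((next j).kraus ω).map fun K => K * prodOp (A j)

/-- The measurement operator `Π_ω = ∑ K† K` of the outcome `ω`. -/
def LOCC.effect {N : ℕ} {Ω : Type} [DecidableEq Ω] {Z X : Fin N → ℕ} (P : LOCC Ω Z X) (ω : Ω) :
    Matrix (Idx X) (Idx X) ℂ :=
  ((P.kraus ω).map fun K => Kᴴ * K).sum

/-- The unnormalised state `∑ K ρ K†` after the outcome `ω`. -/
def LOCC.output {N : ℕ} {Ω : Type} [DecidableEq Ω] {Z X : Fin N → ℕ} (P : LOCC Ω Z X) (ω : Ω)
    (ρ : Matrix (Idx X) (Idx X) ℂ) : Matrix (Idx Z) (Idx Z) ℂ :=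
  ((P.kraus ω).map fun K => K * ρ * Kᴴ).sum

/-- A family of operators is an LOCC measurement if some LOCC protocol implements it. -/
def IsLOCCMeasurement {N : ℕ} {Ω : Type} [DecidableEq Ω] {X : Fin N → ℕ}
    (E : Ω → Matrix (Idx X) (Idx X) ℂ) : Prop :=
  ∃ (Z : Fin N → ℕ) (P : LOCC Ω Z X), ∀ ω, E ω = P.effect ω

/-- `φ → ψ`: some LOCC protocol transforms `|φ⟩` into `|ψ⟩` with positive probability `p`
(`true` announces success). -/
def LocallyTransforms {N : ℕ} {X Z : Fin N → ℕ} (φ : Space X) (ψ : Space Z) : Prop :=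
  ∃ (P : LOCC Bool Z X) (p : ℝ), 0 < p ∧ P.output true (ketbra φ) = (p : ℂ) • ketbra ψ

/-- The SLOCC class of `φ` in its own space: the states interconvertible with `φ`. -/
def sloccClass {N : ℕ} {d : Fin N → ℕ} (φ : Space d) : Set (Space d) :=
  {ψ | IsState ψ ∧ LocallyTransforms φ ψ ∧ LocallyTransforms ψ φ}

/-- A class `C` of states is maximal if every state of the same space that can be transformed
into a member of `C` lies in `C`. -/
def IsMaximalClass {N : ℕ} {d : Fin N → ℕ} (C : Set (Space d)) : Prop :=
  ∀ φ ∈ C, ∀ ψ : Space d, IsState ψ → LocallyTransforms ψ φ → ψ ∈ C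

/-- `φ` is maximally entangled: it is a state whose SLOCC class is maximal. -/
def IsMaximallyEntangled {N : ℕ} {d : Fin N → ℕ} (φ : Space d) : Prop :=
  IsState φ ∧ IsMaximalClass (sloccClass φ)

/-- The states `χ 0, …, χ (D - 1)` can be unambiguously distinguished with LOCC: an LOCC
measurement identifies each of them with positive probability and never misidentifies one;
`none` is the inconclusive outcome. -/
def UnambiguouslyLOCCDistinguishable {N D : ℕ} {X : Fin N → ℕ} (χ : Fin D → Space X) : Prop :=
  ∃ E : Option (Fin D) → Matrix (Idx X) (Idx X) ℂ,
    IsLOCCMeasurement E ∧ ∑ o, E o = 1 ∧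
    ∃ ε : Fin D → ℝ, (∀ i, 0 < ε i) ∧
      ∀ i j, expect (E (some i)) (χ j) = if i = j then (ε i : ℂ) else 0

/-- `Φ` is universal for local unambiguous discrimination in `⨂ₖ ℂ^(d k)`. -/
def IsUniversalUnambiguous {N : ℕ} {d' : Fin N → ℕ} (d : Fin N → ℕ) (Φ : Space d') : Prop :=
  ∀ (D : ℕ) (ψ : Fin D → Space d), (∀ i, IsState (ψ i)) → LinearIndependent ℂ ψ →
    UnambiguouslyLOCCDistinguishable fun i => tensor Φ (ψ i)

end Multipartite

end

/-! Every branch of an LOCC protocol acts by a product operator, and conversely every product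
operator is, up to a nonzero scalar, the only successful branch of some protocol (`exists_filter`).
So `φ → ψ` means that a product operator sends `φ` to a nonzero multiple of `ψ`
(`locallyTransforms_iff`).

A product bra on `H' ⊗ H` bends into a product operator `A : H' → H`, and its value on `Φ ⊗ ψ` is
`⟨A Φ*|ψ⟩` (`sum_bend_mul_tensor`). Identifying `ψ i` without error means finding such an `A Φ*`
orthogonal to the other `ψ j` but not to `ψ i`. Hence `Φ` is universal iff `Φ*` transforms into
every state.

It remains to see that every state is reached from a maximally entangled one. Transformations never
increase the integer `minRank`, and those preserving it are reversible
(`ProductTransforms.minRank_le`). As it is bounded, a state of largest `minRank` among those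
reaching `η` is maximally entangled. -/

namespace Multipartite

/-! ### Algebra of product operators. -/

section ProductOperators

variable {N : ℕ} {X Y Z : Fin N → ℕ}

lemma prodOp_mul (A : ∀ k, Matrix (Fin (Z k)) (Fin (Y k)) ℂ)
    (B : ∀ k, Matrix (Fin (Y k)) (Fin (X k)) ℂ) :
    prodOp A * prodOp B = prodOp fun k => A k * B k := by
  ext z x
  simp only [prodOp, Matrix.mul_apply, Matrix.of_apply, Finset.prod_univ_sum,
    Fintype.piFinset_univ, Finset.prod_mul_distrib]

lemma prodOp_one : prodOp (fun k => (1 : Matrix (Fin (X k)) (Fin (X k)) ℂ)) = 1 := by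
  ext y x
  by_cases h : y = x
  · subst h
    simp [prodOp]
  · obtain ⟨k, hk⟩ := Function.ne_iff.1 h
    simp only [prodOp, Matrix.of_apply, Matrix.one_apply_ne h]
    exact Finset.prod_eq_zero (Finset.mem_univ k) (Matrix.one_apply_ne hk)

lemma prodOp_conjTranspose (A : ∀ k, Matrix (Fin (Y k)) (Fin (X k)) ℂ) :
    (prodOp A)ᴴ = prodOp fun k => (A k)ᴴ := by
  ext y x
  simp [prodOp]

lemma prodOp_update_apply (A : ∀ k, Matrix (Fin (Y k)) (Fin (X k)) ℂ) (k : Fin N)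
    (M : Matrix (Fin (Y k)) (Fin (X k)) ℂ) (y : Idx Y) (x : Idx X) :
    prodOp (Function.update A k M) y x =
      M (y k) (x k) * ∏ l ∈ Finset.univ.erase k, A l (y l) (x l) := by
  simp only [prodOp, Matrix.of_apply]
  rw [← Finset.mul_prod_erase _ _ (Finset.mem_univ k), Function.update_self]
  congr 1
  refine Finset.prod_congr rfl fun l hl => ?_
  rw [Function.update_of_ne (Finset.ne_of_mem_erase hl)]

lemma prodOp_update_smul (A : ∀ k, Matrix (Fin (Y k)) (Fin (X k)) ℂ) (k : Fin N) (c : ℂ) :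
    prodOp (Function.update A k (c • A k)) = c • prodOp A := by
  ext y x
  have h := prodOp_update_apply A k (A k) y x
  rw [Function.update_eq_self] at h
  simp [prodOp_update_apply, mul_assoc, h]

lemma prodOp_update_sum {ι : Type*} (s : Finset ι) (A : ∀ k, Matrix (Fin (Y k)) (Fin (X k)) ℂ)
    (k : Fin N) (M : ι → Matrix (Fin (Y k)) (Fin (X k)) ℂ) :
    ∑ j ∈ s, prodOp (Function.update A k (M j)) =
      prodOp (Function.update A k (∑ j ∈ s, M j)) := by
  ext y x
  simp [Matrix.sum_apply, prodOp_update_apply, Finset.sum_mul]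

end ProductOperators

/-! ### Branches and measurement operators of protocols. -/

section Protocols

variable {N : ℕ} {Ω : Type} [DecidableEq Ω] {X Z : Fin N → ℕ}

lemma LOCC.exists_eq_prodOp (ω : Ω) (P : LOCC Ω Z X) :
    ∀ K ∈ P.kraus ω, ∃ A, K = prodOp A := by
  induction P with
  | halt ω' =>
    intro K hK
    simp only [LOCC.kraus] at hK
    split_ifs at hK
    · exact ⟨fun _ => 1, by rw [prodOp_one]; simpa using hK⟩
    · simp at hK
  | round k m Y A _ _ next ih =>
    intro K hK
    simp only [LOCC.kraus, List.mem_flatMap, List.mem_map] at hK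
    obtain ⟨j, -, K', hK', rfl⟩ := hK
    obtain ⟨B, rfl⟩ := ih j K' hK'
    exact ⟨_, prodOp_mul _ _⟩

lemma sum_map_flatMap {α β M : Type*} [AddCommMonoid M] (l : List α) (f : α → List β)
    (g : β → M) :
    ((l.flatMap f).map g).sum = (l.map fun a => ((f a).map g).sum).sum := by
  induction l with
  | nil => simp
  | cons a l ih => simp [ih]

lemma sum_map_mul_mul {l m n o : Type*} [Fintype m] [Fintype n] (B : Matrix l m ℂ)
    (C : Matrix n o ℂ) (L : List (Matrix m n ℂ)) :
    (L.map fun K => B * K * C).sum = B * L.sum * C := by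
  induction L with
  | nil => simp
  | cons K L ih => simp [ih, Matrix.mul_add, Matrix.add_mul]

lemma LOCC.effect_round {X : Fin N → ℕ} (k : Fin N) (m : ℕ) (Y : Fin m → Fin N → ℕ)
    (A : ∀ (j : Fin m) (l : Fin N), Matrix (Fin (Y j l)) (Fin (X l)) ℂ)
    (measurement : ∑ j, (A j k)ᴴ * A j k = 1)
    (isometry : ∀ j l, l ≠ k → (A j l)ᴴ * A j l = 1)
    (next : ∀ j, LOCC Ω Z (Y j)) (ω : Ω) :
    (LOCC.round k m Y A measurement isometry next).effect ω =
      ∑ j, (prodOp (A j))ᴴ * (next j).effect ω * prodOp (A j) := by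
  rw [LOCC.effect, LOCC.kraus, sum_map_flatMap, ← Fin.sum_univ_def]
  refine Finset.sum_congr rfl fun j _ => ?_
  rw [LOCC.effect, ← sum_map_mul_mul, List.map_map, List.map_map]
  congr 2
  funext K
  simp [Matrix.mul_assoc]

lemma LOCC.sum_effect [Fintype Ω] (P : LOCC Ω Z X) : ∑ ω, P.effect ω = 1 := by
  induction P with
  | halt ω' =>
    rw [Finset.sum_eq_single ω'] <;> simp +contextual [LOCC.effect, LOCC.kraus, eq_comm]
  | round k m Y A measurement isometry next ih =>
    simp only [LOCC.effect_round]
    rw [Finset.sum_comm]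
    simp only [← Matrix.sum_mul, ← Matrix.mul_sum, ih, Matrix.mul_one, prodOp_conjTranspose,
      prodOp_mul]
    have : ∀ j, (fun l => (A j l)ᴴ * A j l) =
        Function.update (fun _ => 1) k ((A j k)ᴴ * A j k) := fun j => by
      funext l
      by_cases h : l = k
      · subst h; simp
      · simp [h, isometry j l h]
    simp only [this]
    rw [prodOp_update_sum, measurement, Function.update_eq_self k (fun _ => _), prodOp_one]

end Protocols

/-! ### Realising product operators by protocols. -/

section Filters

open scoped ComplexOrder MatrixOrder Matrix.Norms.L2Operator in
-- Scaling by `(‖Mᴴ * M‖ + 1)^(-1/2)` makes `M` a contraction, even if `M = 0`; `S` is a root of the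
-- positive defect.
lemma exists_conjTranspose_mul_self_add {x z : ℕ} (M : Matrix (Fin z) (Fin x) ℂ) :
    ∃ (c : ℂ) (S : Matrix (Fin x) (Fin x) ℂ), c ≠ 0 ∧ (c • M)ᴴ * (c • M) + Sᴴ * S = 1 := by
  have h1 : (Mᴴ * M) ≤ algebraMap ℝ (Matrix (Fin x) (Fin x) ℂ) ‖Mᴴ * M‖ :=
    IsSelfAdjoint.le_algebraMap_norm_self (by
      simp [IsSelfAdjoint, Matrix.star_eq_conjTranspose])
  set t : ℝ := ‖Mᴴ * M‖ with ht
  have ht0 : 0 ≤ t := norm_nonneg _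
  have hc : (0 : ℝ) < (t + 1)⁻¹ := by positivity
  have hpos : (1 - (((Real.sqrt (t + 1)⁻¹ : ℝ) : ℂ) • M)ᴴ *
      (((Real.sqrt (t + 1)⁻¹ : ℝ) : ℂ) • M)).PosSemidef := by
    have h2 : (algebraMap ℝ (Matrix (Fin x) (Fin x) ℂ) t - Mᴴ * M).PosSemidef := Matrix.le_iff.1 h1
    have h3 := (h2.add Matrix.PosSemidef.one).smul (a := (t + 1)⁻¹) hc.le
    convert h3 using 1
    have h4 : ((Real.sqrt (t + 1)⁻¹ : ℝ) : ℂ) * ((Real.sqrt (t + 1)⁻¹ : ℝ) : ℂ) =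
        (((t + 1)⁻¹ : ℝ) : ℂ) := by
      rw [← Complex.ofReal_mul, Real.mul_self_sqrt hc.le]
    have h5 : (((t + 1)⁻¹ : ℝ) : ℂ) * (t + 1) = 1 := by
      push_cast; rw [inv_mul_cancel₀]; exact_mod_cast (by positivity : t + 1 ≠ 0)
    rw [Matrix.conjTranspose_smul, Matrix.smul_mul, Matrix.mul_smul, smul_smul]
    simp only [Complex.star_def, Complex.conj_ofReal, h4]
    ext i j
    simp only [Matrix.sub_apply, Matrix.smul_apply, Matrix.add_apply, Algebra.algebraMap_eq_smul_one,
      Complex.real_smul, smul_eq_mul]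
    linear_combination (-(1 : Matrix (Fin x) (Fin x) ℂ) i j) * h5
  obtain ⟨S, hS⟩ := CStarAlgebra.nonneg_iff_eq_star_mul_self.1 (Matrix.nonneg_iff_posSemidef.2 hpos)
  refine ⟨((Real.sqrt (t + 1)⁻¹ : ℝ) : ℂ), S, by exact_mod_cast (Real.sqrt_pos.2 hc).ne', ?_⟩
  rw [← Matrix.star_eq_conjTranspose S, ← hS]
  exact add_sub_cancel _ _

/-- A multiple of any operator is the first Kraus operator of a measurement all of whose Kraus
operators have the same target. -/
lemma exists_measurement {x z : ℕ} (hz : 0 < z) (M : Matrix (Fin z) (Fin x) ℂ) :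
    ∃ (c : ℂ) (F : Fin (x + 1) → Matrix (Fin z) (Fin x) ℂ),
      c ≠ 0 ∧ F 0 = c • M ∧ ∑ j, (F j)ᴴ * F j = 1 := by
  obtain ⟨c, S, hc, hS⟩ := exists_conjTranspose_mul_self_add M
  -- The defect `S` maps into dimension `x`. Reading out its basis label `i` and preparing the basis
  -- vector `0` gives the target dimension `z` without changing the sum.
  let T (i : Fin x) : Matrix (Fin z) (Fin x) ℂ := Matrix.single ⟨0, hz⟩ i 1
  have hT : ∑ i, (T i * S)ᴴ * (T i * S) = Sᴴ * S := by
    have h1 : ∀ i, (T i * S)ᴴ * (T i * S) = Sᴴ * (Matrix.single i i 1 * S) := fun i => by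
      rw [Matrix.conjTranspose_mul, Matrix.mul_assoc, ← Matrix.mul_assoc (T i)ᴴ]
      simp [T, Matrix.conjTranspose_single]
    simp only [h1]
    rw [← Matrix.mul_sum, ← Matrix.sum_mul, Matrix.sum_single_one, Matrix.one_mul]
  refine ⟨c, Fin.cons (α := fun _ => Matrix (Fin z) (Fin x) ℂ) (c • M) fun i => T i * S,
    hc, rfl, ?_⟩
  rw [Fin.sum_univ_succ]
  simp only [Fin.cons_zero, Fin.cons_succ]
  rw [hT, hS]

variable {N : ℕ} {Ω : Type} [DecidableEq Ω] {Z : Fin N → ℕ}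

/-- Induction on the set `s` of parties whose operators need not be isometries; one of them measures
in each round. After a failure the other parties must still reach the dimensions `Z`, so the
induction hypothesis is also used with `succ = fail`. -/
lemma exists_filter_of_isometry (hZ : ∀ k, 0 < Z k) (s : Finset (Fin N)) :
    ∀ {X : Fin N → ℕ} (A : ∀ k, Matrix (Fin (Z k)) (Fin (X k)) ℂ),
      (∀ k ∉ s, (A k)ᴴ * A k = 1) → ∀ succ fail : Ω,
      ∃ (P : LOCC Ω Z X) (c : ℂ), c ≠ 0 ∧
        (succ ≠ fail → P.kraus succ = [c • prodOp A]) ∧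
        ∀ ω, ω ≠ succ → ω ≠ fail → P.kraus ω = [] := by
  induction s using Finset.induction_on with
  | empty =>
    intro X A hA succ fail
    rcases isEmpty_or_nonempty (Fin N) with hN | ⟨⟨k⟩⟩
    · obtain rfl : X = Z := Subsingleton.elim _ _
      obtain rfl : A = fun _ => 1 := Subsingleton.elim _ _
      refine ⟨.halt succ, 1, one_ne_zero, fun _ => ?_, fun ω h _ => ?_⟩
      · simp [LOCC.kraus, prodOp_one]
      · simp [LOCC.kraus, h.symm]
    · refine ⟨.round k 1 (fun _ => Z) (fun _ => A) (by simpa using hA k (by simp))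
        (fun _ l _ => hA l (by simp)) (fun _ => .halt succ), 1, one_ne_zero,
        fun _ => ?_, fun ω h _ => ?_⟩
      · simp [LOCC.kraus, List.finRange_succ]
      · simp [LOCC.kraus, h.symm]
  | insert k s hk ih =>
    intro X A hA succ fail
    obtain ⟨c, F, hc, hF0, hF⟩ := exists_measurement (hZ k) (A k)
    have key : ∀ (j : Fin (X k + 1)) (l : Fin N), ∃ (y : ℕ) (B : Matrix (Fin y) (Fin (X l)) ℂ)
        (A' : Matrix (Fin (Z l)) (Fin y) ℂ),
        Bᴴ * B = Function.update (fun l => (1 : Matrix (Fin (X l)) (Fin (X l)) ℂ)) k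
          ((F j)ᴴ * F j) l ∧ (l ∉ s → A'ᴴ * A' = 1) ∧ A' * B = Function.update A k (F j) l := by
      intro j l
      by_cases h : l = k
      · subst h
        exact ⟨Z l, F j, 1, by simp, by simp, by simp⟩
      · exact ⟨X l, 1, A l, by simp [h], fun hl => hA l (by simp [h, hl]), by simp [h]⟩
    choose Y B A' hB hA' hAB using key
    choose P c' hc' hP hP' using fun (j : Fin (X k + 1)) (ω : Ω) =>
      ih (A' j) (fun l hl => hA' j l hl) ω fail
    refine ⟨.round k (X k + 1) Y B (by simpa [hB] using hF) (fun j l h => by simp [hB, h])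
      (Fin.cases (P 0 succ) fun j => P j.succ fail), c' 0 succ * c, mul_ne_zero (hc' _ _) hc,
      fun h => ?_, fun ω h h' => ?_⟩
    · have h0 : ∀ j : Fin (X k), (P j.succ fail).kraus succ = [] := fun j => hP' _ _ _ h h
      simp only [LOCC.kraus, List.finRange_succ, List.flatMap_cons, List.flatMap_map,
        Fin.cases_zero, Fin.cases_succ, h0, hP 0 succ h, List.map_cons, List.map_nil,
        Matrix.smul_mul, prodOp_mul]
      rw [show (fun l => A' 0 l * B 0 l) = _ from funext (hAB 0), hF0, prodOp_update_smul,
        smul_smul]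
      simp
    · simp only [LOCC.kraus, List.flatMap_eq_nil_iff, List.map_eq_nil_iff]
      intro j _
      refine Fin.cases ?_ (fun j => ?_) j
      · exact hP' _ _ _ h h'
      · exact hP' _ _ _ h' h'

lemma exists_filter (hZ : ∀ k, 0 < Z k) {X : Fin N → ℕ}
    (A : ∀ k, Matrix (Fin (Z k)) (Fin (X k)) ℂ) {succ fail : Ω} (h : succ ≠ fail) :
    ∃ (P : LOCC Ω Z X) (c : ℂ), c ≠ 0 ∧ P.kraus succ = [c • prodOp A] ∧
      ∀ ω, ω ≠ succ → ω ≠ fail → P.kraus ω = [] := by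
  obtain ⟨P, c, hc, h1, h2⟩ := exists_filter_of_isometry hZ Finset.univ A (by simp) succ fail
  exact ⟨P, c, hc, h1 h, h2⟩

end Filters

/-! ### LOCC transformations as product operators. -/

section Transformations

variable {N : ℕ} {W X Y Z : Fin N → ℕ}

/-- Some product operator sends `φ` to a nonzero multiple of `ψ`. -/
def ProductTransforms (φ : Space X) (ψ : Space Z) : Prop :=
  ∃ (A : ∀ k, Matrix (Fin (Z k)) (Fin (X k)) ℂ) (c : ℂ), c ≠ 0 ∧
    prodOp A *ᵥ φ.ofLp = c • ψ.ofLp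

lemma ProductTransforms.trans {φ : Space X} {ψ : Space Y} {χ : Space Z}
    (h : ProductTransforms φ ψ) (h' : ProductTransforms ψ χ) : ProductTransforms φ χ := by
  obtain ⟨A, c, hc, hA⟩ := h
  obtain ⟨B, c', hc', hB⟩ := h'
  refine ⟨fun k => B k * A k, c * c', mul_ne_zero hc hc', ?_⟩
  rw [← prodOp_mul, ← Matrix.mulVec_mulVec, hA, Matrix.mulVec_smul, hB, smul_smul]

lemma ProductTransforms.refl (φ : Space X) : ProductTransforms φ φ :=
  ⟨fun _ => 1, 1, one_ne_zero, by simp [prodOp_one]⟩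

lemma IsState.ne_zero {φ : Space X} (h : IsState φ) : φ ≠ 0 := by
  rintro rfl
  simp [IsState] at h

lemma IsState.dim_pos {φ : Space X} (h : IsState φ) (k : Fin N) : 0 < X k := by
  by_contra hk
  have : IsEmpty (Idx X) := ⟨fun x => hk (Fin.pos (x k))⟩
  exact h.ne_zero (Subsingleton.elim _ _)

lemma mul_ketbra_mul (K : Matrix (Idx Z) (Idx X) ℂ) (φ : Space X) :
    K * ketbra φ * Kᴴ = Matrix.vecMulVec (K *ᵥ φ.ofLp) (star (K *ᵥ φ.ofLp)) := by
  rw [ketbra, Matrix.mul_vecMulVec, Matrix.vecMulVec_mul, Matrix.star_mulVec]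

lemma dotProduct_vecMulVec_mulVec {ι : Type*} [Fintype ι] (u v : ι → ℂ) :
    star u ⬝ᵥ (Matrix.vecMulVec v (star v) *ᵥ u) = ((‖star v ⬝ᵥ u‖ ^ 2 : ℝ) : ℂ) := by
  have h : star u ⬝ᵥ v = star (star v ⬝ᵥ u) := by
    rw [Matrix.star_dotProduct]
  rw [Matrix.vecMulVec_mulVec, dotProduct_smul, h]
  simp [Complex.conj_mul']

lemma ProductTransforms.locallyTransforms {φ : Space X} {ψ : Space Z} (hψ : IsState ψ)
    (h : ProductTransforms φ ψ) : LocallyTransforms φ ψ := by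
  obtain ⟨A, c, hc, hA⟩ := h
  obtain ⟨P, c', hc', hP, -⟩ :=
    exists_filter (fun k => hψ.dim_pos k) A (Bool.true_eq_false_eq_False : ¬ true = false)
  refine ⟨P, ‖c' * c‖ ^ 2, pow_pos (norm_pos_iff.2 (mul_ne_zero hc' hc)) 2, ?_⟩
  simp only [LOCC.output, hP, List.map_cons, List.map_nil, List.sum_cons, List.sum_nil, add_zero]
  rw [mul_ketbra_mul, Matrix.smul_mulVec, hA, smul_smul, ketbra]
  ext i j
  have := Complex.mul_conj' (c' * c)
  simp only [Matrix.vecMulVec_apply, Matrix.smul_apply, Pi.smul_apply, Pi.star_apply, smul_eq_mul,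
    star_mul', Complex.star_def, Complex.ofReal_pow]
  rw [← this]
  simp only [map_mul]
  ring

lemma exists_eq_smul_of_forall_orthogonal {φ ψ : Space X}
    (h : ∀ χ : Space X, inner ℂ ψ χ = 0 → inner ℂ φ χ = 0) : ∃ c : ℂ, φ = c • ψ := by
  have h1 : φ ∈ (ℂ ∙ ψ)ᗮᗮ := by
    rw [Submodule.mem_orthogonal']
    intro χ hχ
    exact h χ (Submodule.mem_orthogonal_singleton_iff_inner_right.1 hχ)
  rw [Submodule.orthogonal_orthogonal, Submodule.mem_span_singleton] at h1
  obtain ⟨c, hc⟩ := h1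
  exact ⟨c, hc.symm⟩

lemma inner_eq_dotProduct (φ ψ : Space X) : inner ℂ φ ψ = star φ.ofLp ⬝ᵥ ψ.ofLp := by
  rw [EuclideanSpace.inner_eq_star_dotProduct, dotProduct_comm]

lemma ketbra_quadratic (φ χ : Space X) :
    star χ.ofLp ⬝ᵥ (ketbra φ *ᵥ χ.ofLp) = ((‖(inner ℂ φ χ : ℂ)‖ ^ 2 : ℝ) : ℂ) := by
  rw [ketbra, dotProduct_vecMulVec_mulVec, inner_eq_dotProduct]

lemma quadratic_list_sum {ι : Type*} [Fintype ι] (u : ι → ℂ) (L : List (Matrix ι ι ℂ)) :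
    star u ⬝ᵥ (L.sum *ᵥ u) = (L.map fun K => star u ⬝ᵥ (K *ᵥ u)).sum := by
  induction L with
  | nil => simp
  | cons K L ih => simp [Matrix.add_mulVec, dotProduct_add, ih]

lemma ofReal_list_sum (L : List ℝ) : ((L.sum : ℝ) : ℂ) = (L.map fun x : ℝ => (x : ℂ)).sum := by
  induction L with
  | nil => simp
  | cons K L ih => simp [ih]

lemma list_sum_eq_zero_iff_of_nonneg {α : Type*} (L : List α) (f : α → ℝ) (hf : ∀ a, 0 ≤ f a) :
    (L.map f).sum = 0 ↔ ∀ a ∈ L, f a = 0 := by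
  induction L with
  | nil => simp
  | cons a L ih =>
    have : 0 ≤ (L.map f).sum := List.sum_nonneg (by simp +contextual [hf])
    simp [← ih, add_eq_zero_iff_of_nonneg (hf a) this]

lemma output_quadratic {Ω : Type} [DecidableEq Ω] (P : LOCC Ω Z X) (ω : Ω) (φ : Space X)
    (χ : Space Z) :
    star χ.ofLp ⬝ᵥ (P.output ω (ketbra φ) *ᵥ χ.ofLp) =
      ((((P.kraus ω).map fun K => ‖star (K *ᵥ φ.ofLp) ⬝ᵥ χ.ofLp‖ ^ 2).sum : ℝ) : ℂ) := by
  rw [LOCC.output, quadratic_list_sum, ofReal_list_sum, List.map_map, List.map_map]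
  congr 2
  funext K
  simp only [Function.comp, mul_ketbra_mul, dotProduct_vecMulVec_mulVec]

/-- The output is a sum of positive rank-one terms equal to `p |ψ⟩⟨ψ|`, so every successful branch
yields a multiple of `ψ`; since `p > 0`, some branch is nonzero. -/
lemma LocallyTransforms.productTransforms {φ : Space X} {ψ : Space Z} (hψ : IsState ψ)
    (h : LocallyTransforms φ ψ) : ProductTransforms φ ψ := by
  obtain ⟨P, p, hp, hP⟩ := h
  have hq : ∀ χ : Space Z, p * ‖(inner ℂ ψ χ : ℂ)‖ ^ 2 =
      ((P.kraus true).map fun K => ‖star (K *ᵥ φ.ofLp) ⬝ᵥ χ.ofLp‖ ^ 2).sum := fun χ => by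
    have h1 := output_quadratic P true φ χ
    rw [hP, Matrix.smul_mulVec, dotProduct_smul, ketbra_quadratic, smul_eq_mul] at h1
    exact_mod_cast h1
  have hne : ∃ K ∈ P.kraus true, K *ᵥ φ.ofLp ≠ 0 := by
    by_contra! hcon
    have h1 := hq ψ
    rw [(list_sum_eq_zero_iff_of_nonneg _ _ fun K => by positivity).2
      fun K hK => by simp [hcon K hK]] at h1
    have h2 : (inner ℂ ψ ψ : ℂ) ≠ 0 := inner_self_ne_zero.2 hψ.ne_zero
    have : 0 < p * ‖(inner ℂ ψ ψ : ℂ)‖ ^ 2 := by positivity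
    exact this.ne' h1
  obtain ⟨K, hK, hK0⟩ := hne
  obtain ⟨c, hc⟩ := exists_eq_smul_of_forall_orthogonal (φ := WithLp.toLp 2 (K *ᵥ φ.ofLp)) (ψ := ψ)
    fun χ hχ => by
      have h1 := hq χ
      rw [hχ, norm_zero, zero_pow two_ne_zero, mul_zero, eq_comm,
        list_sum_eq_zero_iff_of_nonneg _ _ fun K => by positivity] at h1
      rw [inner_eq_dotProduct]
      simpa using h1 K hK
  obtain ⟨A, rfl⟩ := P.exists_eq_prodOp true K hK
  have hc' : prodOp A *ᵥ φ.ofLp = c • ψ.ofLp := congrArg WithLp.ofLp hc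
  refine ⟨A, c, ?_, hc'⟩
  rintro rfl
  exact hK0 (by simpa using hc')

lemma locallyTransforms_iff {φ : Space X} {ψ : Space Z} (hψ : IsState ψ) :
    LocallyTransforms φ ψ ↔ ProductTransforms φ ψ :=
  ⟨fun h => h.productTransforms hψ, fun h => h.locallyTransforms hψ⟩

end Transformations

/-! ### Maximally entangled states above a given state. -/

section Maximal

variable {N : ℕ} {d : Fin N → ℕ}

/-- The total ranks of the product operators with `φ` in their range. -/
def totalRanks (φ : Space d) : Set ℕ :=
  {r | ∃ (A : ∀ k, Matrix (Fin (d k)) (Fin (d k)) ℂ) (χ : Idx d → ℂ),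
    prodOp A *ᵥ χ = φ.ofLp ∧ ∑ k, (A k).rank = r}

lemma totalRanks_nonempty (φ : Space d) : (totalRanks φ).Nonempty :=
  ⟨_, fun _ => 1, φ.ofLp, by simp [prodOp_one], rfl⟩

/-- The least total rank of a product operator with `φ` in its range. -/
noncomputable def minRank (φ : Space d) : ℕ := sInf (totalRanks φ)

lemma minRank_le (φ : Space d) : minRank φ ≤ ∑ k, d k :=
  Nat.sInf_le ⟨fun _ => 1, φ.ofLp, by simp [prodOp_one], by simp⟩

/-- Equality of ranks makes `B` injective on the range of `A`, where it has a left inverse. -/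
lemma exists_mul_eq_of_rank_mul_eq {n : ℕ} (A B : Matrix (Fin n) (Fin n) ℂ)
    (h : (B * A).rank = A.rank) : ∃ C : Matrix (Fin n) (Fin n) ℂ, C * (B * A) = A := by
  let f := B.mulVecLin.domRestrict (LinearMap.range A.mulVecLin)
  have hf : LinearMap.ker f = ⊥ := by
    have h1 := LinearMap.finrank_range_add_finrank_ker f
    have h2 : LinearMap.range f = LinearMap.range (B * A).mulVecLin := by
      rw [Matrix.mulVecLin_mul, LinearMap.range_comp, LinearMap.range_domRestrict]
    rw [h2] at h1
    simp only [Matrix.rank] at h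
    exact Submodule.finrank_eq_zero.1 (by omega)
  obtain ⟨g, hg⟩ := f.exists_leftInverse_of_injective hf
  refine ⟨LinearMap.toMatrix' (Submodule.subtype _ ∘ₗ g), ?_⟩
  refine Matrix.mulVec_injective (funext fun v => ?_)
  have h3 := LinearMap.congr_fun hg ⟨A *ᵥ v, v, rfl⟩
  rw [← Matrix.mulVec_mulVec, ← Matrix.mulVec_mulVec, LinearMap.toMatrix'_mulVec]
  exact congrArg Subtype.val h3

/-- If `A` attains the minimum for `φ`, then `B A` has `ψ` in its range and no larger ranks. In case
of equality each local rank is preserved, so each `B k` can be undone on the range of `A k`. -/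
lemma ProductTransforms.minRank_le {φ ψ : Space d} (h : ProductTransforms φ ψ) :
    minRank ψ ≤ minRank φ ∧ (minRank φ ≤ minRank ψ → ProductTransforms ψ φ) := by
  obtain ⟨B, c, hc, hB⟩ := h
  obtain ⟨A, χ, hA, hr⟩ := Nat.sInf_mem (totalRanks_nonempty φ)
  change _ = minRank φ at hr
  have hBA : prodOp (fun k => B k * A k) *ᵥ χ = c • ψ.ofLp := by
    rw [← prodOp_mul, ← Matrix.mulVec_mulVec, hA, hB]
  have h1 : minRank ψ ≤ ∑ k, (B k * A k).rank :=
    Nat.sInf_le ⟨_, c⁻¹ • χ, by rw [Matrix.mulVec_smul, hBA, inv_smul_smul₀ hc], rfl⟩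
  have h2 : ∀ k ∈ Finset.univ, (B k * A k).rank ≤ (A k).rank :=
    fun k _ => Matrix.rank_mul_le_right _ _
  refine ⟨hr ▸ h1.trans (Finset.sum_le_sum h2), fun h3 => ?_⟩
  have h4 := (Finset.sum_eq_sum_iff_of_le h2).1
    (le_antisymm (Finset.sum_le_sum h2) ((hr.le.trans h3).trans h1))
  choose C hC using fun k => exists_mul_eq_of_rank_mul_eq (A k) (B k) (h4 k (Finset.mem_univ k))
  refine ⟨C, c⁻¹, inv_ne_zero hc, ?_⟩
  have h5 : prodOp C *ᵥ (c • ψ.ofLp) = φ.ofLp := by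
    rw [← hBA, Matrix.mulVec_mulVec, prodOp_mul]
    simp only [hC, hA]
  rw [← h5, Matrix.mulVec_smul, inv_smul_smul₀ hc]

lemma exists_isMaximallyEntangled {η : Space d} (hη : IsState η) :
    ∃ φ : Space d, IsMaximallyEntangled φ ∧ ProductTransforms φ η := by
  let S : Set ℕ := {r | ∃ ψ : Space d, IsState ψ ∧ ProductTransforms ψ η ∧ minRank ψ = r}
  have hS : S.Nonempty := ⟨_, η, hη, .refl η, rfl⟩
  have hb : BddAbove S := ⟨∑ k, d k, by rintro _ ⟨ψ, -, -, rfl⟩; exact minRank_le ψ⟩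
  obtain ⟨ψ, hψ, hψη, hr⟩ := Nat.sSup_mem hS hb
  refine ⟨ψ, ⟨hψ, ?_⟩, hψη⟩
  rintro φ ⟨hφ, -, hφψ⟩ χ hχ hχφ
  have h1 : ProductTransforms χ ψ :=
    ((locallyTransforms_iff hφ).1 hχφ).trans ((locallyTransforms_iff hψ).1 hφψ)
  have h2 : minRank χ ≤ minRank ψ := hr ▸ le_csSup hb ⟨χ, hχ, h1.trans hψη, rfl⟩
  exact ⟨hχ, (locallyTransforms_iff hχ).2 (h1.minRank_le.2 h2), (locallyTransforms_iff hψ).2 h1⟩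

end Maximal

/-! ### Bending, dual states and discrimination. -/

section Universality

variable {N : ℕ} {d' d X Z : Fin N → ℕ}

/-- The amplitudes `⟨a|` of the bra on `ℂ^m ⊗ ℂ^n` that corresponds to `A : ℂ^m → ℂ^n`. -/
def bend {m n : ℕ} (A : Matrix (Fin n) (Fin m) ℂ) (z : Fin (m * n)) : ℂ :=
  star (A (finProdFinEquiv.symm z).2 (finProdFinEquiv.symm z).1)

lemma exists_bend_eq {m n : ℕ} (a : Fin (m * n) → ℂ) :
    ∃ A : Matrix (Fin n) (Fin m) ℂ, bend A = a :=
  ⟨Matrix.of fun y x => star (a (finProdFinEquiv (x, y))), by ext z; simp [bend, -finProdFinEquiv_symm_apply]⟩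

/-- Product labels of a joint system are pairs of product labels. -/
def jointEquiv (d' d : Fin N → ℕ) : Idx (joint d' d) ≃ Idx d' × Idx d where
  toFun z := (fun k => (finProdFinEquiv.symm (z k)).1, fun k => (finProdFinEquiv.symm (z k)).2)
  invFun p := fun k => finProdFinEquiv (p.1 k, p.2 k)
  left_inv z := by ext k; simp [-finProdFinEquiv_symm_apply]
  right_inv p := by ext k <;> simp [-finProdFinEquiv_symm_apply]

/-- The conjugate of `Φ` enters here: the bra carries conjugated entries of `A`, and pulling the
conjugation out of the sum over `H'` moves it onto `Φ`. -/
lemma sum_bend_mul_tensor (A : ∀ k, Matrix (Fin (d k)) (Fin (d' k)) ℂ) (Φ : Space d')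
    (ψ : Space d) :
    ∑ z, (∏ k, bend (A k) (z k)) * tensor Φ ψ z =
      star (prodOp A *ᵥ (conjState Φ).ofLp) ⬝ᵥ ψ.ofLp := by
  rw [← (jointEquiv d' d).symm.sum_comp, Fintype.sum_prod_type_right]
  simp only [dotProduct, Matrix.mulVec, Pi.star_apply, star_sum, Finset.sum_mul]
  refine Finset.sum_congr rfl fun y _ => Finset.sum_congr rfl fun x _ => ?_
  simp [jointEquiv, bend, tensor, prodOp, conjState, mul_assoc, -finProdFinEquiv_symm_apply]

lemma expect_effect {Ω : Type} [DecidableEq Ω] (P : LOCC Ω Z X) (ω : Ω) (χ : Space X) :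
    expect (P.effect ω) χ =
      ((((P.kraus ω).map fun K => ∑ z, ‖(K *ᵥ χ.ofLp) z‖ ^ 2).sum : ℝ) : ℂ) := by
  rw [expect, LOCC.effect, quadratic_list_sum, ofReal_list_sum, List.map_map, List.map_map]
  congr 2
  funext K
  simp only [Function.comp]
  rw [← Matrix.mulVec_mulVec, Matrix.dotProduct_mulVec, ← Matrix.star_mulVec]
  simp [dotProduct, Complex.conj_mul']

/-- Apply universality to an orthonormal basis containing `η`. A conclusive branch for `η` has a
row, which is a product bra, nonzero on `Φ ⊗ η` and zero on the other `Φ ⊗ b j`. Bent, it sends `Φ*`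
to a multiple of `η`. -/
lemma IsUniversalUnambiguous.productTransforms {Φ : Space d'} (h : IsUniversalUnambiguous d Φ)
    {η : Space d} (hη : IsState η) : ProductTransforms (conjState Φ) η := by
  have ho : Orthonormal ℂ ((↑) : ({η} : Set (Space d)) → Space d) :=
    ⟨fun x => by rw [x.2]; exact hη, fun x y hxy => (hxy (Subsingleton.elim _ _)).elim⟩
  obtain ⟨u, b', hu, hb'⟩ := ho.exists_orthonormalBasis_extension
  let b := b'.reindex u.equivFin
  obtain ⟨i, hi⟩ : ∃ i, b i = η := by
    refine ⟨u.equivFin ⟨η, by simpa using hu⟩, ?_⟩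
    simp [b, hb']
  obtain ⟨E, ⟨Z, P, hP⟩, -, ε, hε, hE⟩ := h _ b (fun j => b.orthonormal.1 j)
    b.orthonormal.linearIndependent
  have hE' : ∀ j, ((P.kraus (some i)).map fun K =>
      ∑ z, ‖(K *ᵥ (tensor Φ (b j)).ofLp) z‖ ^ 2).sum = if i = j then ε i else 0 := fun j => by
    have := hE i j
    rw [hP, expect_effect] at this
    split_ifs with hij
    · rw [if_pos hij] at this; exact_mod_cast this
    · rw [if_neg hij] at this; exact_mod_cast this
  have hne : ∃ K ∈ P.kraus (some i), K *ᵥ (tensor Φ (b i)).ofLp ≠ 0 := by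
    by_contra! hcon
    have h1 := hE' i
    rw [if_pos rfl, (list_sum_eq_zero_iff_of_nonneg _ _ fun K => by positivity).2
      fun K hK => by simp [hcon K hK]] at h1
    exact (hε i).ne h1
  obtain ⟨K, hK, hK0⟩ := hne
  obtain ⟨z, hz⟩ := Function.ne_iff.1 hK0
  have hK1 : ∀ j, i ≠ j → (K *ᵥ (tensor Φ (b j)).ofLp) z = 0 := fun j hij => by
    have h1 := hE' j
    rw [if_neg hij, list_sum_eq_zero_iff_of_nonneg _ _ fun K => by positivity] at h1
    have h2 := (Finset.sum_eq_zero_iff_of_nonneg fun z _ => by positivity).1 (h1 K hK) z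
      (Finset.mem_univ z)
    simpa using h2
  obtain ⟨B, rfl⟩ := P.exists_eq_prodOp _ K hK
  choose A hA using fun k => exists_bend_eq (B k (z k))
  have hpair : ∀ j, (prodOp B *ᵥ (tensor Φ (b j)).ofLp) z =
      inner ℂ (WithLp.toLp 2 (prodOp A *ᵥ (conjState Φ).ofLp)) (b j) := fun j => by
    rw [inner_eq_dotProduct, ← sum_bend_mul_tensor]
    simp [hA, Matrix.mulVec, dotProduct, prodOp]
  obtain ⟨c, hc⟩ := exists_eq_smul_of_forall_orthogonal
      (φ := WithLp.toLp 2 (prodOp A *ᵥ (conjState Φ).ofLp)) (ψ := η) fun χ hχ => by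
    rw [← b.sum_inner_mul_inner]
    refine Finset.sum_eq_zero fun j _ => ?_
    by_cases hij : i = j
    · rw [← hij, hi, hχ, mul_zero]
    · rw [← hpair, hK1 j hij, zero_mul]
  refine ⟨A, c, ?_, congrArg WithLp.ofLp hc⟩
  rintro rfl
  rw [hpair, hc, zero_smul, inner_zero_left] at hz
  exact hz rfl

/-- The component of `ψ i` orthogonal to the span of the others, normalised. -/
lemma exists_state_dual {D : ℕ} {ψ : Fin D → Space d} (h : LinearIndependent ℂ ψ) (i : Fin D) :
    ∃ η : Space d, IsState η ∧ (∀ j, j ≠ i → inner ℂ η (ψ j) = 0) ∧ inner ℂ η (ψ i) ≠ 0 := by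
  let W := Submodule.span ℂ (ψ '' {j | j ≠ i})
  have hi : ψ i ∉ W := h.notMem_span_image (by simp)
  let η := ψ i - W.starProjection (ψ i)
  have hη : η ≠ 0 := fun h0 => hi (by
    rw [sub_eq_zero.1 h0]; exact Submodule.starProjection_apply_mem _ _)
  have hW : ∀ w ∈ W, inner ℂ η w = 0 := fun w hw =>
    Submodule.inner_left_of_mem_orthogonal hw (Submodule.sub_starProjection_mem_orthogonal _)
  refine ⟨((‖η‖⁻¹ : ℝ) : ℂ) • η, ?_, fun j hj => ?_, ?_⟩
  · rw [IsState, norm_smul, Complex.norm_real, norm_inv, norm_norm,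
      inv_mul_cancel₀ (norm_ne_zero_iff.2 hη)]
  · rw [inner_smul_left, hW _ (Submodule.subset_span ⟨j, hj, rfl⟩), mul_zero]
  · have h1 : ψ i = η + W.starProjection (ψ i) := (sub_add_cancel _ _).symm
    rw [inner_smul_left, h1, inner_add_right, hW _ (Submodule.starProjection_apply_mem _ _),
      add_zero]
    refine mul_ne_zero ?_ (inner_self_ne_zero.2 hη)
    simpa using hη

/-- With shared randomness, which is available as soon as there is a party to produce it, finitely
many local filters can be combined into one protocol. -/
lemma exists_random_filter {D : ℕ} (hD : D ≤ 1 ∨ 0 < N) (hZ : ∀ k, 0 < Z k)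
    (R : ∀ (_ : Fin D) (k : Fin N), Matrix (Fin (Z k)) (Fin (X k)) ℂ) :
    ∃ P : LOCC (Option (Fin D)) Z X, ∀ i, ∃ c : ℂ, c ≠ 0 ∧
      P.kraus (some i) = [c • prodOp (R i)] := by
  rcases Nat.eq_zero_or_pos D with rfl | hD0
  · obtain ⟨P, -⟩ := exists_filter_of_isometry (Ω := Option (Fin 0)) hZ Finset.univ
      (X := X) (fun _ => 0) (by simp) none none
    exact ⟨P, fun i => i.elim0⟩
  choose P c hc hP hP' using fun i : Fin D => exists_filter hZ (R i) (Option.some_ne_none i)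
  rcases Nat.eq_zero_or_pos N with hN | hN
  · obtain rfl : D = 1 := by omega
    refine ⟨P 0, fun i => ⟨c 0, hc 0, ?_⟩⟩
    obtain rfl := Subsingleton.elim i 0
    exact hP 0
  · let k : Fin N := ⟨0, hN⟩
    -- The Kraus operators `t • 1` draw a uniform index, each with probability `1 / D`.
    let t : ℂ := ((Real.sqrt (D : ℝ)⁻¹ : ℝ) : ℂ)
    have hDpos : (0 : ℝ) < (D : ℝ)⁻¹ := by positivity
    have ht0 : t ≠ 0 := Complex.ofReal_ne_zero.2 (Real.sqrt_pos.2 hDpos).ne'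
    have ht : (D : ℂ) * (t * star t) = 1 := by
      simp only [t, Complex.star_def, Complex.conj_ofReal, ← Complex.ofReal_mul,
        Real.mul_self_sqrt hDpos.le]
      push_cast
      exact mul_inv_cancel₀ (by exact_mod_cast hD0.ne')
    let A : ∀ l, Matrix (Fin (X l)) (Fin (X l)) ℂ := Function.update (fun _ => 1) k (t • 1)
    have hA : prodOp A = t • 1 := by
      rw [← prodOp_one, ← prodOp_update_smul _ k]
    refine ⟨.round k D (fun _ => X) (fun _ => A) ?_ (fun j l h => by simp [A, h]) P,
      fun i => ⟨c i * t, mul_ne_zero (hc i) ht0, ?_⟩⟩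
    · simp only [A, Function.update_self, Finset.sum_const, Finset.card_univ, Fintype.card_fin,
        Matrix.conjTranspose_smul, Matrix.conjTranspose_one, Matrix.mul_smul,
        Matrix.mul_one, smul_smul, ← Nat.cast_smul_eq_nsmul ℂ]
      rw [ht, one_smul]
    -- The filter drawn with index `j` announces only `some j` or `none`, so it contributes to `some
    -- i` only when `j = i`.
    · have h0 : ∀ j, ((P j).kraus (some i)).map (fun K => K * prodOp A) =
          if j = i then [(c i * t) • prodOp (R i)] else [] := fun j => by
        split_ifs with hij
        · subst hij
          simp [hP, hA, smul_smul, mul_comm]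
        · simp [hP' j (some i) (by simpa using fun h => hij h.symm) (by simp)]
      simp only [LOCC.kraus, h0]
      have h1 : ∀ L : List (Fin D), L.Nodup → i ∈ L →
          (L.flatMap fun j => if j = i then [(c i * t) • prodOp (R i)] else []) =
            [(c i * t) • prodOp (R i)] := by
        intro L hL hi
        induction L with
        | nil => simp at hi
        | cons j L ih =>
          rw [List.nodup_cons] at hL
          by_cases hj : j = i
          · subst hj
            rw [List.flatMap_cons, if_pos rfl, List.flatMap_eq_nil_iff.2, List.append_nil]
            intro l hl
            exact if_neg (ne_of_mem_of_not_mem hl hL.1)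
          · rw [List.flatMap_cons, if_neg hj, List.nil_append]
            exact ih hL.2 ((List.mem_cons.1 hi).resolve_left fun h => hj h.symm)
      exact h1 _ (List.nodup_finRange D) (List.mem_finRange i)

lemma isUniversalUnambiguous_of_productTransforms {Φ : Space d'}
    (h : ∀ η : Space d, IsState η → ProductTransforms (conjState Φ) η) :
    IsUniversalUnambiguous d Φ := by
  intro D ψ _ hψ
  choose η hη h0 h1 using exists_state_dual hψ
  choose A c hc hA using fun i => h (η i) (hη i)
  -- With no parties `H` is one-dimensional, so at most one state has to be identified.
  have hD : D ≤ 1 ∨ 0 < N := by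
    rcases Nat.eq_zero_or_pos N with rfl | hN
    · left
      simpa using hψ.fintype_card_le_finrank
    · exact .inr hN
  -- All target dimensions are `1`, so each filter is a product bra.
  obtain ⟨P, hP⟩ := exists_random_filter (Z := fun _ => 1) hD (fun _ => one_pos)
    (fun i k => Matrix.of fun _ z => bend (A i k) z)
  choose t ht hP using hP
  have hpair : ∀ i (φ : Space d) z, ((t i • prodOp (Y := fun _ => 1)
      (fun k => Matrix.of fun _ z => bend (A i k) z)) *ᵥ (tensor Φ φ).ofLp) z = t i * (star (c i) * inner ℂ (η i) φ) := fun i φ z => by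
    rw [inner_eq_dotProduct, Matrix.smul_mulVec, Pi.smul_apply, smul_eq_mul, ← smul_eq_mul (star _),
      ← smul_dotProduct, ← star_smul, ← hA, ← sum_bend_mul_tensor]
    simp [Matrix.mulVec, dotProduct, prodOp]
  refine ⟨P.effect, ⟨_, P, fun _ => rfl⟩, P.sum_effect,
    fun i => ‖t i * (star (c i) * inner ℂ (η i) (ψ i))‖ ^ 2, fun i => ?_, fun i j => ?_⟩
  · exact pow_pos (norm_pos_iff.2 (mul_ne_zero (ht i)
      (mul_ne_zero (star_ne_zero.2 (hc i)) (h1 i)))) 2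
  · rw [expect_effect, hP]
    simp only [List.map_cons, List.map_nil, List.sum_cons, List.sum_nil, add_zero, hpair]
    split_ifs with hij
    · subst hij
      simp
    · simp [h0 i j (Ne.symm hij)]

end Universality

end Multipartite

theorem mainTheorem5 {N : ℕ} (d' d : Fin N → ℕ) (Φ : Multipartite.Space d')
    (hΦ : Multipartite.IsState Φ) :
    Multipartite.IsUniversalUnambiguous d Φ ↔
      ∀ φ : Multipartite.Space d, Multipartite.IsMaximallyEntangled φ →
        Multipartite.LocallyTransforms (Multipartite.conjState Φ) φ := by
  constructor
  · intro h φ hφ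
    exact (h.productTransforms hφ.1).locallyTransforms hφ.1
  · intro h
    refine Multipartite.isUniversalUnambiguous_of_productTransforms fun η hη => ?_
    obtain ⟨φ, hφ, hφη⟩ := Multipartite.exists_isMaximallyEntangled hη
    exact ((h φ hφ).productTransforms hφ.1).trans hφη
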